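/- For $n\in\mathbb N$, $n\ge 1$, and $1\le p<\infty$ let $\|x\|_p=\big(\sum_{i=1}^n|x_i|^p\big)^{1/p}$ for $x\in\mathbb R^n$, let $\mathbb B_p^n=\{x\in\mathbb R^n:\|x\|_p\le 1\}$ and $\mathbb S_p^{n-1}=\{x\in\mathbb R^n:\|x\|_p=1\}$, and let $\mathbf M_{\mathbb B_p^n}$ be the cone probability measure of $\mathbb B_p^n$, that is, the Borel probability measure on $\mathbb S_p^{n-1}$ given by \[ \mathbf M_{\mathbb B_p^n}(B)=\frac{\mathrm{vol}_n\big(\{rx:x\in B,\ 0\le r\le 1\}\big)}{\mathrm{vol}_n(\mathbb B_p^n)},\qquad B\subseteq\mathbb S_p^{n-1}\text{ Borel}. \] For a measurable function $f:\mathbb S_p^{n-1}\to\mathbb R$ let \[ \|f\|_{\psi_2}=\inf\Big\{\lambda>0:\int_{\mathbb S_p^{n-1}}\Big(e^{|f|^2/\lambda^2}-1\Big)\,d\mathbf M_{\mathbb B_p^n}\le 1\Big\} \] (with $\inf\emptyset=\infty$) be its Luxemburg norm with respect to the Orlicz function $\psi_2(x)=e^{x^2}-1$. There exists an absolute constant $c\in(0,\infty)$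 such that, for every $n\ge1$, every $1\le p<2$ and every $\theta\in\mathbb R^n$ with $\|\theta\|_\infty=\max_{1\le i\le n}|\theta_i|=1$, \[ \Big\|\frac{1}{n^{1/2-1/p}}\langle\,\cdot\,,\theta\rangle\Big\|_{\psi_2}\le c . \] -/

import Mathlib

open MeasureTheory Set
open scoped ENNReal

namespace ConeMeasure

/-- The `ℓ_p` norm on `ℝⁿ` (for `1 ≤ p < ∞`). -/
noncomputable def pNorm {n : ℕ} (p : ℝ) (x : Fin n → ℝ) : ℝ :=
  (∑ i, |x i| ^ p) ^ (1 / p)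

/-- The unit ball of `ℓ_p^n`. -/
def pBall (n : ℕ) (p : ℝ) : Set (Fin n → ℝ) := {x | pNorm p x ≤ 1}

/-- The unit sphere of `ℓ_p^n`. -/
def pSphere (n : ℕ) (p : ℝ) : Set (Fin n → ℝ) := {x | pNorm p x = 1}

/-- The set `{r x : x ∈ B, 0 ≤ r ≤ 1}`. -/
def cone {n : ℕ} (B : Set (Fin n → ℝ)) : Set (Fin n → ℝ) :=
  {y | ∃ x ∈ B, ∃ r : ℝ, 0 ≤ r ∧ r ≤ 1 ∧ y = r • x}

theorem pNorm_smul {n : ℕ} {p : ℝ} (hp : 1 ≤ p) {r : ℝ} (hr : 0 ≤ r) (x : Fin n → ℝ) :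
    pNorm p (r • x) = r * pNorm p x := by
  have hp0 : p ≠ 0 := by linarith
  have h : ∑ i, |(r • x) i| ^ p = r ^ p * ∑ i, |x i| ^ p := by
    rw [Finset.mul_sum]
    refine Finset.sum_congr rfl fun i _ => ?_
    rw [Pi.smul_apply, smul_eq_mul, abs_mul, abs_of_nonneg hr,
      Real.mul_rpow hr (abs_nonneg _)]
  unfold pNorm
  rw [h, Real.mul_rpow (Real.rpow_nonneg hr _)
    (Finset.sum_nonneg fun i _ => Real.rpow_nonneg (abs_nonneg _) _),
    ← Real.rpow_mul hr, mul_one_div_cancel hp0, Real.rpow_one]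

theorem measurable_pNorm {n : ℕ} (p : ℝ) :
    Measurable (fun x : Fin n → ℝ => pNorm p x) := by
  unfold pNorm
  fun_prop

theorem measurableSet_pSphere (n : ℕ) (p : ℝ) : MeasurableSet (pSphere n p) :=
  measurable_pNorm p (measurableSet_singleton 1)

theorem cone_iUnion {n : ℕ} (B : ℕ → Set (Fin n → ℝ)) :
    cone (⋃ i, B i) = ⋃ i, cone (B i) := by
  ext y
  simp only [cone, mem_ofPred_eq, mem_iUnion]
  constructor
  · rintro ⟨x, ⟨i, hi⟩, h⟩
    exact ⟨i, x, hi, h⟩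
  · rintro ⟨i, x, hi, h⟩
    exact ⟨x, ⟨i, hi⟩, h⟩

theorem cone_diff_zero {n : ℕ} {p : ℝ} (hp : 1 ≤ p) {B : Set (Fin n → ℝ)}
    (hB : B ⊆ pSphere n p) :
    cone B \ {0} = {y | 0 < pNorm p y ∧ pNorm p y ≤ 1 ∧ (pNorm p y)⁻¹ • y ∈ B} := by
  ext y
  constructor
  · rintro ⟨⟨x, hx, r, hr0, hr1, rfl⟩, hy⟩
    have hr : r ≠ 0 := by
      rintro rfl
      exact hy (by simp)
    have hx1 : pNorm p x = 1 := hB hx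
    have h1 : pNorm p (r • x) = r := by rw [pNorm_smul hp hr0, hx1, mul_one]
    refine ⟨?_, ?_, ?_⟩
    · rw [h1]
      exact lt_of_le_of_ne hr0 hr.symm
    · rw [h1]
      exact hr1
    · rw [h1, smul_smul, inv_mul_cancel₀ hr, one_smul]
      exact hx
  · rintro ⟨h0, h1, hy⟩
    refine ⟨⟨_, hy, pNorm p y, h0.le, h1, ?_⟩, ?_⟩
    · rw [smul_smul, mul_inv_cancel₀ h0.ne', one_smul]
    · rintro rfl
      have h : pNorm p (0 : Fin n → ℝ) = 0 := by
        simpa using pNorm_smul hp le_rfl (0 : Fin n → ℝ)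
      exact h0.ne' h

theorem measurableSet_cone {n : ℕ} {p : ℝ} (hp : 1 ≤ p) {B : Set (Fin n → ℝ)}
    (hB : B ⊆ pSphere n p) (hm : MeasurableSet B) : MeasurableSet (cone B) := by
  have hd : MeasurableSet (cone B \ {0}) := by
    rw [cone_diff_zero hp hB]
    have hN := measurable_pNorm (n := n) p
    exact (measurableSet_lt measurable_const hN).inter
      ((measurableSet_le hN measurable_const).inter ((hN.inv.smul measurable_id) hm))
  by_cases h : (0 : Fin n → ℝ) ∈ cone B
  · have : cone B = (cone B \ {0}) ∪ {0} := by
      rw [sdiff_union_self, union_eq_self_of_subset_right (singleton_subset_iff.2 h)]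
    rw [this]
    exact hd.union (measurableSet_singleton 0)
  · rwa [sdiff_singleton_eq_self h] at hd

theorem aedisjoint_cone {n : ℕ} {p : ℝ} (hp : 1 ≤ p) {A B : Set (Fin n → ℝ)}
    (hA : A ⊆ pSphere n p) (hB : B ⊆ pSphere n p) (hAB : Disjoint A B) :
    AEDisjoint volume (cone A) (cone B) := by
  have hsub : cone A ∩ cone B ⊆ {0} := by
    rintro y ⟨h1, h2⟩
    by_contra hy
    have a : y ∈ cone A \ {0} := ⟨h1, hy⟩
    have b : y ∈ cone B \ {0} := ⟨h2, hy⟩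
    rw [cone_diff_zero hp hA] at a
    rw [cone_diff_zero hp hB] at b
    exact Set.disjoint_left.1 hAB a.2.2 b.2.2
  rcases Nat.eq_zero_or_pos n with rfl | hn
  · have hA0 : A = ∅ := by
      refine eq_empty_iff_forall_notMem.2 fun x hx => ?_
      have h := hA hx
      have h0 : (1 / p : ℝ) ≠ 0 := by positivity
      simp [pSphere, pNorm] at h
      rw [Real.zero_rpow (by positivity)] at h
      exact zero_ne_one h
    have : cone A = ∅ := by
      rw [hA0]
      ext y
      simp [cone]
    simp [AEDisjoint, this]
  · have : Nonempty (Fin n) := ⟨⟨0, hn⟩⟩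
    exact measure_mono_null hsub (measure_singleton 0)

/-- The cone probability measure of the unit ball of `ℓ_p^n`, a Borel measure on the unit
sphere: the measure of `B` is `vol {r x : x ∈ B, 0 ≤ r ≤ 1} / vol (ball)`. -/
noncomputable def coneMeasure (n : ℕ) (p : ℝ) (hp : 1 ≤ p) : Measure (pSphere n p) :=
  Measure.ofMeasurable
    (fun B _ => volume (cone (Subtype.val '' B)) / volume (pBall n p))
    (by simp [cone])
    (by
      intro B hB hd
      have hS : ∀ i, (Subtype.val '' B i : Set (Fin n → ℝ)) ⊆ pSphere n p := by
        rintro i _ ⟨x, _, rfl⟩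
        exact x.2
      have h : volume (cone (⋃ i, (Subtype.val '' B i : Set (Fin n → ℝ))))
          = ∑' i, volume (cone (Subtype.val '' B i : Set (Fin n → ℝ))) := by
        rw [cone_iUnion]
        refine measure_iUnion₀ (fun i j hij => ?_) (fun i => ?_)
        · exact aedisjoint_cone hp (hS i) (hS j)
            ((disjoint_image_iff Subtype.val_injective).2 (hd hij))
        · exact (measurableSet_cone hp (hS i)
            ((measurableSet_pSphere n p).subtype_image (hB i))).nullMeasurableSet
      simp only [image_iUnion]
      rw [h]
      simp only [div_eq_mul_inv]
      rw [ENNReal.tsum_mul_right])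

/-- The Orlicz function `ψ₂`. -/
noncomputable def psi2 (x : ℝ) : ℝ := Real.exp (x ^ 2) - 1

/-- The Luxemburg norm of `f` for the Orlicz function `M`. It is extended-valued: it is `∞`
exactly when no `t > 0` has `∫ M(|f| / t) dμ ≤ 1`. -/
noncomputable def luxemburgNorm {Ω : Type*} [MeasurableSpace Ω] (M : ℝ → ℝ) (μ : Measure Ω)
    (f : Ω → ℝ) : ℝ≥0∞ :=
  sInf {s | ∃ t : ℝ, 0 < t ∧ s = ENNReal.ofReal t ∧
    ∫⁻ ω, ENNReal.ofReal (M (|f ω| / t)) ∂μ ≤ 1}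

end ConeMeasure

/-!
Let `X = (G₁, …, Gₙ)` have independent coordinates with density proportional to `exp (-|t| ^ p)`.
The density of `X` depends on `‖X‖_p` only, so by polar decomposition `‖X‖_p` and `X / ‖X‖_p` are
independent, and the second has the cone measure as its law. Jensen's inequality in the radial
variable gives `𝔼 exp (s 𝔼‖X‖_p ⟨X / ‖X‖_p, θ⟩) ≤ 𝔼 exp (s ⟨X, θ⟩)`, and the right side factorises
over the coordinates and is at most `exp (C s² n)` for `|s| ≤ 1 / 4`. Since `𝔼‖X‖_p` is at least of
order `n ^ (1 / p)`, this is a sub-Gaussian bound for `Y = n ^ (1 / p - 1 / 2) ⟨·, θ⟩` at every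
parameter `u` with `|u|` up to order `√n`. For larger `|u|` the bound `|Y| ≤ √n` already gives
`u Y ≤ C u²`. Hence `Y` is sub-Gaussian with an absolute constant, and so has bounded `ψ₂` norm.
-/

namespace ConeMeasure

open Real ProbabilityTheory
open scoped NNReal

/-! ### Sub-Gaussian variables and the `ψ₂` norm -/

theorem lintegral_exp_mul_sq_gaussianReal {a : ℝ} (ha : a < 1 / 2) :
    ∫⁻ x, ENNReal.ofReal (exp (a * x ^ 2)) ∂gaussianReal 0 1
      = ENNReal.ofReal (√(1 - 2 * a))⁻¹ := by
  have hd : 0 < 1 - 2 * a := by linarith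
  have hsqrt : √(1 - 2 * a) ≠ 0 := (sqrt_pos.2 hd).ne'
  obtain ⟨v, hv⟩ : ∃ v : ℝ≥0, (v : ℝ) = (1 - 2 * a)⁻¹ := ⟨⟨_, (inv_pos.2 hd).le⟩, rfl⟩
  have hv0 : v ≠ 0 := NNReal.coe_ne_zero.1 (hv ▸ (inv_pos.2 hd).ne')
  have hpdf (x : ℝ) : gaussianPDF 0 1 x * ENNReal.ofReal (exp (a * x ^ 2))
      = ENNReal.ofReal (√(1 - 2 * a))⁻¹ * gaussianPDF 0 v x := by
    have hexp : -(x - 0) ^ 2 / (2 * 1) + a * x ^ 2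
        = -(x - 0) ^ 2 / (2 * (1 - 2 * a)⁻¹) := by field_simp; ring
    simp only [gaussianPDF_def]
    rw [← ENNReal.ofReal_mul (gaussianPDFReal_nonneg _ _ _), ← ENNReal.ofReal_mul (by positivity),
      gaussianPDFReal, gaussianPDFReal, NNReal.coe_one, hv, mul_assoc, ← exp_add, hexp, mul_one,
      sqrt_mul (by positivity) (1 - 2 * a)⁻¹, sqrt_inv]
    congr 1
    field_simp
  rw [gaussianReal_of_var_ne_zero 0 one_ne_zero,
    lintegral_withDensity_eq_lintegral_mul _ (measurable_gaussianPDF 0 1) (by fun_prop)]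
  simp only [Pi.mul_apply, hpdf]
  rw [lintegral_const_mul _ (measurable_gaussianPDF _ _), lintegral_gaussianPDF_eq_one 0 hv0,
    mul_one]

theorem lintegral_exp_mul_gaussianReal (t : ℝ) :
    ∫⁻ s, ENNReal.ofReal (exp (t * s)) ∂gaussianReal 0 1
      = ENNReal.ofReal (exp (t ^ 2 / 2)) := by
  rw [← ofReal_integral_eq_lintegral_ofReal (integrable_exp_mul_gaussianReal t)
    (ae_of_all _ fun _ => (exp_pos _).le)]
  have h := congrFun (mgf_id_gaussianReal (μ := 0) (v := 1)) t
  simp only [mgf, id_eq] at h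
  rw [h]
  simp

section SubGaussian

variable {Ω : Type*} [MeasurableSpace Ω] {μ : Measure Ω} {X : Ω → ℝ} {c : ℝ≥0}

/- Gaussian linearisation: `exp (y ^ 2 / 2) = 𝔼 exp (y G)` for a standard Gaussian `G`, so the
integral of `exp ((X / t) ^ 2)` is an average of values of the moment generating function. -/
theorem lintegral_exp_sq_le_of_hasSubgaussianMGF [SFinite μ] (hX : HasSubgaussianMGF X c μ)
    {t : ℝ} (ht : 0 < t) (hct : 2 * c < t ^ 2) :
    ∫⁻ ω, ENNReal.ofReal (exp ((X ω / t) ^ 2)) ∂μ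
      ≤ ENNReal.ofReal (√(1 - 2 * (c / t ^ 2)))⁻¹ := by
  have hlin (ω : Ω) : ENNReal.ofReal (exp ((X ω / t) ^ 2))
      = ∫⁻ s, ENNReal.ofReal (exp (√2 / t * s * X ω)) ∂gaussianReal 0 1 := by
    have hcomm (s : ℝ) : √2 / t * s * X ω = √2 / t * X ω * s := by ring
    simp only [hcomm]
    rw [lintegral_exp_mul_gaussianReal, mul_pow, div_pow, div_pow, sq_sqrt zero_le_two]
    congr 2
    ring
  have hmgf (s : ℝ) : ∫⁻ ω, ENNReal.ofReal (exp (√2 / t * s * X ω)) ∂μ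
      ≤ ENNReal.ofReal (exp (c / t ^ 2 * s ^ 2)) := by
    rw [← ofReal_integral_eq_lintegral_ofReal (hX.integrable_exp_mul _)
      (ae_of_all _ fun _ => (exp_pos _).le)]
    refine ENNReal.ofReal_le_ofReal ((hX.mgf_le _).trans_eq ?_)
    rw [mul_pow, div_pow, sq_sqrt zero_le_two]
    congr 1
    ring
  calc ∫⁻ ω, ENNReal.ofReal (exp ((X ω / t) ^ 2)) ∂μ
      = ∫⁻ s, ∫⁻ ω, ENNReal.ofReal (exp (√2 / t * s * X ω)) ∂μ ∂gaussianReal 0 1 := by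
        simp only [hlin]
        refine lintegral_lintegral_swap ?_
        exact (((measurable_snd.const_mul (√2 / t)).aemeasurable.mul
          hX.aemeasurable.comp_fst).exp).ennreal_ofReal
    _ ≤ ∫⁻ s, ENNReal.ofReal (exp (c / t ^ 2 * s ^ 2)) ∂gaussianReal 0 1 :=
        lintegral_mono hmgf
    _ = ENNReal.ofReal (√(1 - 2 * (c / t ^ 2)))⁻¹ := by
        refine lintegral_exp_mul_sq_gaussianReal ?_
        rw [div_lt_iff₀ (by positivity)]
        linarith

theorem luxemburgNorm_psi2_le_of_hasSubgaussianMGF [IsProbabilityMeasure μ]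
    (hX : HasSubgaussianMGF X c μ) (hc : 0 < c) :
    luxemburgNorm psi2 μ X ≤ ENNReal.ofReal (2 * √c) := by
  have hc' : (0 : ℝ) < c := hc
  have ht : 0 < 2 * √(c : ℝ) := by positivity
  have htsq : (2 * √(c : ℝ)) ^ 2 = 4 * c := by rw [mul_pow, sq_sqrt hc'.le]; norm_num
  refine sInf_le ⟨2 * √c, ht, rfl, ?_⟩
  have hexp : ∫⁻ ω, ENNReal.ofReal (exp ((X ω / (2 * √c)) ^ 2)) ∂μ ≤ 2 := by
    refine (lintegral_exp_sq_le_of_hasSubgaussianMGF hX ht (by rw [htsq]; linarith)).trans ?_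
    have hhalf : 1 - 2 * (c / (2 * √(c : ℝ)) ^ 2) = 2⁻¹ := by
      rw [htsq]; field_simp; norm_num
    rw [hhalf, sqrt_inv, inv_inv, ENNReal.ofReal_le_ofNat]
    exact sqrt_le_iff.2 (by norm_num)
  calc ∫⁻ ω, ENNReal.ofReal (psi2 (|X ω| / (2 * √c))) ∂μ
      = ∫⁻ ω, (ENNReal.ofReal (exp ((X ω / (2 * √c)) ^ 2)) - 1) ∂μ := by
        simp only [psi2, div_pow, sq_abs, ENNReal.ofReal_sub _ zero_le_one, ENNReal.ofReal_one]
    _ = ∫⁻ ω, ENNReal.ofReal (exp ((X ω / (2 * √c)) ^ 2)) ∂μ - 1 := by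
        rw [lintegral_sub' aemeasurable_const (by simp)
          (ae_of_all _ fun ω => ENNReal.one_le_ofReal.2 (one_le_exp (sq_nonneg _)))]
        simp
    _ ≤ 1 := tsub_le_iff_right.2 (by rwa [one_add_one_eq_two])

end SubGaussian

theorem exp_le_one_add_add_sq_mul_exp_abs (y : ℝ) : exp y ≤ 1 + y + y ^ 2 * exp |y| := by
  have h := Complex.norm_exp_sub_sum_le_norm_mul_exp y 2
  simp only [Finset.sum_range_succ, Finset.sum_range_zero, pow_zero, pow_one, Nat.factorial_zero,
    Nat.factorial_one, Nat.cast_one, div_one, zero_add, Complex.norm_real, norm_eq_abs,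
    sq_abs] at h
  have hre := (le_abs_self _).trans ((Complex.abs_re_le_norm _).trans h)
  rw [← Complex.ofReal_exp] at hre
  simp only [Complex.sub_re, Complex.add_re, Complex.one_re, Complex.ofReal_re] at hre
  linarith

theorem exp_mul_le_of_abs_le_half {a s : ℝ} (ha : 0 < a) (hs : |s| ≤ a / 2) (x : ℝ) :
    exp (s * x) ≤ 1 + s * x + 8 * s ^ 2 / a ^ 2 * exp (a * |x|) := by
  have hz : 0 ≤ a * |x| / 2 := by positivity
  have hexp : exp (a * |x|) = exp (a * |x| / 2) * exp (a * |x| / 2) := by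
    rw [← exp_add, add_halves]
  have hsq : (s * x) ^ 2 ≤ 8 * s ^ 2 / a ^ 2 * exp (a * |x| / 2) := by
    have hquad := quadratic_le_exp_of_nonneg hz
    calc (s * x) ^ 2 = 8 * s ^ 2 / a ^ 2 * ((a * |x| / 2) ^ 2 / 2) := by
          rw [div_pow, mul_pow, mul_pow, sq_abs]; field_simp; norm_num
      _ ≤ 8 * s ^ 2 / a ^ 2 * exp (a * |x| / 2) := by gcongr; linarith
  have habs : |s * x| ≤ a * |x| / 2 := by
    rw [abs_mul, mul_div_right_comm]; gcongr
  calc exp (s * x) ≤ 1 + s * x + (s * x) ^ 2 * exp |s * x| :=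
        exp_le_one_add_add_sq_mul_exp_abs _
    _ ≤ 1 + s * x + 8 * s ^ 2 / a ^ 2 * exp (a * |x| / 2) * exp (a * |x| / 2) := by gcongr
    _ = 1 + s * x + 8 * s ^ 2 / a ^ 2 * exp (a * |x|) := by rw [hexp, mul_assoc]

section Centered

variable {Ω : Type*} [MeasurableSpace Ω] {μ : Measure Ω} {X : Ω → ℝ} {a s : ℝ}

theorem integrable_exp_mul_of_integrable_exp_mul_abs (hX : AEMeasurable X μ)
    (hexp : Integrable (fun ω => exp (a * |X ω|)) μ) (hs : |s| ≤ a) :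
    Integrable (fun ω => exp (s * X ω)) μ := by
  refine hexp.mono' (hX.const_mul s).exp.aestronglyMeasurable (ae_of_all _ fun ω => ?_)
  rw [norm_of_nonneg (exp_pos _).le, exp_le_exp]
  calc s * X ω ≤ |s| * |X ω| := (le_abs_self _).trans_eq (abs_mul _ _)
    _ ≤ a * |X ω| := by gcongr

theorem integrable_of_integrable_exp_mul_abs (ha : 0 < a) (hX : AEMeasurable X μ)
    (hexp : Integrable (fun ω => exp (a * |X ω|)) μ) : Integrable X μ := by
  refine (hexp.const_mul a⁻¹).mono' hX.aestronglyMeasurable (ae_of_all _ fun ω => ?_)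
  rw [norm_eq_abs, ← div_eq_inv_mul, le_div_iff₀' ha]
  linarith [add_one_le_exp (a * |X ω|)]

theorem mgf_le_exp_sq_of_integral_eq_zero [IsProbabilityMeasure μ] (ha : 0 < a)
    (hX : AEMeasurable X μ) (hexp : Integrable (fun ω => exp (a * |X ω|)) μ)
    (hmean : ∫ ω, X ω ∂μ = 0) (hs : |s| ≤ a / 2) :
    mgf X μ s ≤ exp (8 * (∫ ω, exp (a * |X ω|) ∂μ) / a ^ 2 * s ^ 2) := by
  have hint := integrable_of_integrable_exp_mul_abs ha hX hexp
  have hlin : Integrable (fun ω => 1 + s * X ω) μ := (integrable_const 1).add (hint.const_mul s)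
  calc mgf X μ s ≤ ∫ ω, (1 + s * X ω + 8 * s ^ 2 / a ^ 2 * exp (a * |X ω|)) ∂μ :=
        integral_mono (integrable_exp_mul_of_integrable_exp_mul_abs hX hexp (by linarith))
          (hlin.add (hexp.const_mul _))
          fun ω => exp_mul_le_of_abs_le_half ha hs (X ω)
    _ = 8 * (∫ ω, exp (a * |X ω|) ∂μ) / a ^ 2 * s ^ 2 + 1 := by
        rw [integral_add hlin (hexp.const_mul _),
          integral_add (integrable_const 1) (hint.const_mul s), integral_const_mul,
          integral_const_mul, hmean, integral_const, probReal_univ, smul_eq_mul]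
        ring
    _ ≤ _ := add_one_le_exp _

end Centered

/-! ### The `p`-generalised Gaussian distribution -/

/-- The `p`-generalised Gaussian distribution on `ℝ`, whose density is proportional to
`exp (-|t| ^ p)`. Its `n`-th power has a density depending on `pNorm p` only. -/
noncomputable def pGaussian (p : ℝ) : Measure ℝ := volume.tilted fun t => -|t| ^ p

theorem integral_exp_neg_mul_abs {c : ℝ} (hc : 0 < c) :
    ∫ t : ℝ, exp (-c * |t|) = 2 / c := by
  rw [integral_comp_abs (f := fun t => exp (-c * t)), integral_exp_mul_Ioi (neg_lt_zero.2 hc)]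
  simp [div_eq_mul_inv]

theorem integrable_exp_neg_mul_abs {c : ℝ} (hc : 0 < c) :
    Integrable fun t : ℝ => exp (-c * |t|) :=
  not_imp_comm.1 integral_undef (integral_exp_neg_mul_abs hc ▸ (div_pos two_pos hc).ne')

section PGaussian

variable {p : ℝ}

theorem abs_le_one_add_abs_rpow (hp : 1 ≤ p) (t : ℝ) : |t| ≤ 1 + |t| ^ p := by
  rcases le_total |t| 1 with h | h
  · linarith [rpow_nonneg (abs_nonneg t) p]
  · linarith [self_le_rpow_of_one_le h hp]

theorem exp_neg_abs_rpow_mul_exp_le (hp : 1 ≤ p) (b t : ℝ) :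
    exp (-|t| ^ p) * exp (b * |t|) ≤ exp 1 * exp (-(1 - b) * |t|) := by
  rw [← exp_add, ← exp_add, exp_le_exp]
  linarith [abs_le_one_add_abs_rpow hp t]

theorem integrable_exp_neg_abs_rpow_mul_exp (hp : 1 ≤ p) {b : ℝ} (hb : b < 1) :
    Integrable fun t : ℝ => exp (-|t| ^ p) * exp (b * |t|) := by
  refine ((integrable_exp_neg_mul_abs (sub_pos.2 hb)).const_mul (exp 1)).mono'
    (by fun_prop) (ae_of_all _ fun t => ?_)
  rw [norm_of_nonneg (by positivity)]
  exact exp_neg_abs_rpow_mul_exp_le hp b t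

theorem integral_exp_neg_abs_rpow_mul_exp_le (hp : 1 ≤ p) {b : ℝ} (hb : b < 1) :
    ∫ t : ℝ, exp (-|t| ^ p) * exp (b * |t|) ≤ exp 1 * (2 / (1 - b)) := by
  rw [← integral_exp_neg_mul_abs (sub_pos.2 hb), ← integral_const_mul]
  exact integral_mono (integrable_exp_neg_abs_rpow_mul_exp hp hb)
    ((integrable_exp_neg_mul_abs (sub_pos.2 hb)).const_mul _) (exp_neg_abs_rpow_mul_exp_le hp b)

theorem integrable_exp_neg_abs_rpow (hp : 1 ≤ p) : Integrable fun t : ℝ => exp (-|t| ^ p) := by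
  simpa using integrable_exp_neg_abs_rpow_mul_exp hp zero_lt_one

theorem integral_exp_neg_abs_rpow_le (hp : 1 ≤ p) :
    ∫ t : ℝ, exp (-|t| ^ p) ≤ 2 * exp 1 := by
  simpa [mul_comm] using integral_exp_neg_abs_rpow_mul_exp_le hp zero_lt_one

theorem exp_neg_one_le_exp_neg_abs_rpow (hp : 0 ≤ p) {t : ℝ} (ht : |t| ≤ 1) :
    exp (-1) ≤ exp (-|t| ^ p) :=
  exp_le_exp.2 (neg_le_neg (rpow_le_one (abs_nonneg t) ht hp))

theorem mul_exp_neg_one_le_integral (hp : 0 ≤ p) {g : ℝ → ℝ} (hg : ∀ t, 0 ≤ g t)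
    (hint : Integrable fun t => exp (-|t| ^ p) * g t) (hgi : IntegrableOn g (Icc (-1) 1)) :
    exp (-1) * ∫ t in Icc (-1) 1, g t ≤ ∫ t, exp (-|t| ^ p) * g t := by
  rw [← integral_const_mul]
  calc ∫ t in Icc (-1) 1, exp (-1) * g t ≤ ∫ t in Icc (-1) 1, exp (-|t| ^ p) * g t :=
        setIntegral_mono_on (hgi.const_mul _) hint.integrableOn measurableSet_Icc fun t ht =>
          mul_le_mul_of_nonneg_right (exp_neg_one_le_exp_neg_abs_rpow hp (abs_le.2 ht)) (hg t)
    _ ≤ ∫ t, exp (-|t| ^ p) * g t :=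
        setIntegral_le_integral hint (ae_of_all _ fun t => mul_nonneg (exp_pos _).le (hg t))

theorem two_mul_exp_neg_one_le_integral (hp : 1 ≤ p) :
    2 * exp (-1) ≤ ∫ t : ℝ, exp (-|t| ^ p) := by
  have h := mul_exp_neg_one_le_integral (p := p) (by linarith) (fun _ => zero_le_one)
    (by simpa using integrable_exp_neg_abs_rpow hp) (by simp)
  simp only [integral_const, mul_one, smul_eq_mul] at h
  norm_num at h
  linarith

theorem isProbabilityMeasure_pGaussian (hp : 1 ≤ p) : IsProbabilityMeasure (pGaussian p) :=
  isProbabilityMeasure_tilted (integrable_exp_neg_abs_rpow hp)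

theorem integral_pGaussian (p : ℝ) (g : ℝ → ℝ) :
    ∫ t, g t ∂pGaussian p = (∫ t, exp (-|t| ^ p) * g t) / ∫ t : ℝ, exp (-|t| ^ p) := by
  rw [pGaussian, integral_tilted, ← integral_div]
  simp only [smul_eq_mul, div_mul_eq_mul_div]

theorem integral_id_pGaussian (p : ℝ) : ∫ t, t ∂pGaussian p = 0 := by
  rw [integral_pGaussian, div_eq_zero_iff]
  left
  have h := integral_neg_eq_self (fun t : ℝ => exp (-|t| ^ p) * t) volume
  simp only [abs_neg, mul_neg, integral_neg] at h
  linarith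

theorem integrable_exp_mul_abs_pGaussian (hp : 1 ≤ p) {b : ℝ} (hb : b < 1) :
    Integrable (fun t => exp (b * |t|)) (pGaussian p) :=
  (integrable_tilted_iff (integrable_exp_neg_abs_rpow hp) _).2
    (integrable_exp_neg_abs_rpow_mul_exp hp hb)

theorem integrable_abs_pGaussian (hp : 1 ≤ p) : Integrable (fun t => |t|) (pGaussian p) :=
  (integrable_of_integrable_exp_mul_abs one_half_pos aemeasurable_id
    (integrable_exp_mul_abs_pGaussian hp one_half_lt_one)).abs

theorem integral_exp_half_mul_abs_pGaussian_le (hp : 1 ≤ p) :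
    ∫ t, exp (1 / 2 * |t|) ∂pGaussian p ≤ 2 * exp 2 := by
  rw [integral_pGaussian]
  calc (∫ t, exp (-|t| ^ p) * exp (1 / 2 * |t|)) / ∫ t : ℝ, exp (-|t| ^ p)
      ≤ exp 1 * (2 / (1 - 1 / 2)) / (2 * exp (-1)) :=
        div_le_div₀ (by norm_num; positivity)
          (integral_exp_neg_abs_rpow_mul_exp_le hp (by norm_num)) (by positivity)
          (two_mul_exp_neg_one_le_integral hp)
    _ = 2 * exp 2 := by
        have h : exp 2 = exp 1 * exp 1 := by rw [← exp_add]; norm_num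
        rw [exp_neg, h]; field_simp; norm_num

theorem integral_abs_Icc_neg_one_one : ∫ t in Icc (-1 : ℝ) 1, |t| = 1 := by
  rw [integral_Icc_eq_integral_Ioc, ← intervalIntegral.integral_of_le (by norm_num),
    ← intervalIntegral.integral_add_adjacent_intervals (b := 0)
      (continuous_abs.intervalIntegrable _ _) (continuous_abs.intervalIntegrable _ _),
    intervalIntegral.integral_congr (g := fun t => -t) fun t ht =>
      abs_of_nonpos (uIcc_of_le (neg_one_lt_zero (R := ℝ)).le ▸ ht).2,
    intervalIntegral.integral_congr (a := 0) (g := fun t => t) fun t ht =>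
      abs_of_nonneg (uIcc_of_le (zero_le_one (α := ℝ)) ▸ ht).1,
    intervalIntegral.integral_neg, integral_id, integral_id]
  norm_num

theorem exp_neg_two_div_two_le_integral_abs_pGaussian (hp : 1 ≤ p) :
    exp (-2) / 2 ≤ ∫ t, |t| ∂pGaussian p := by
  have hint : Integrable (fun t : ℝ => exp (-|t| ^ p) * |t|) :=
    (integrable_tilted_iff (integrable_exp_neg_abs_rpow hp) _).1 (integrable_abs_pGaussian hp)
  have hnum := mul_exp_neg_one_le_integral (by linarith) abs_nonneg hint
    continuous_abs.continuousOn.integrableOn_Icc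
  rw [integral_abs_Icc_neg_one_one, mul_one] at hnum
  rw [integral_pGaussian]
  calc exp (-2) / 2 = exp (-1) / (2 * exp 1) := by
        have h : exp (-2) = exp (-1) * exp (-1) := by rw [← exp_add]; norm_num
        rw [h, exp_neg]; field_simp
    _ ≤ (∫ t, exp (-|t| ^ p) * |t|) / ∫ t : ℝ, exp (-|t| ^ p) :=
        div_le_div₀ (hnum.trans' (exp_pos _).le) hnum
          ((two_mul_exp_neg_one_le_integral hp).trans_lt' (by positivity))
          (integral_exp_neg_abs_rpow_le hp)

theorem mgf_id_pGaussian_le (hp : 1 ≤ p) {s : ℝ} (hs : |s| ≤ 1 / 4) :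
    mgf id (pGaussian p) s ≤ exp (64 * exp 2 * s ^ 2) := by
  have := isProbabilityMeasure_pGaussian hp
  refine (mgf_le_exp_sq_of_integral_eq_zero one_half_pos aemeasurable_id
    (integrable_exp_mul_abs_pGaussian hp one_half_lt_one) (integral_id_pGaussian p)
    (hs.trans_eq (by norm_num))).trans (exp_le_exp.2 ?_)
  gcongr
  rw [div_le_iff₀ (by norm_num)]
  have h := integral_exp_half_mul_abs_pGaussian_le hp
  simp only [id_eq]
  linarith

end PGaussian

/-! ### Its product measure -/

section PNorm

variable {n : ℕ} {p : ℝ}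

theorem pNorm_nonneg (p : ℝ) (x : Fin n → ℝ) : 0 ≤ pNorm p x :=
  rpow_nonneg (Finset.sum_nonneg fun _ _ => rpow_nonneg (abs_nonneg _) _) _

theorem pNorm_rpow (hp : p ≠ 0) (x : Fin n → ℝ) :
    pNorm p x ^ p = ∑ i, |x i| ^ p := by
  rw [pNorm, ← rpow_mul (Finset.sum_nonneg fun _ _ => rpow_nonneg (abs_nonneg _) _),
    one_div_mul_cancel hp, rpow_one]

theorem pNorm_le_sum_abs (hp : 1 ≤ p) (x : Fin n → ℝ) :
    pNorm p x ≤ ∑ i, |x i| := by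
  have hS : 0 ≤ ∑ i, |x i| := Finset.sum_nonneg fun i _ => abs_nonneg (x i)
  have hsplit {t : ℝ} (ht : 0 ≤ t) : t ^ p = t ^ (p - 1) * t := by
    rw [← rpow_add_one' ht (by linarith), sub_add_cancel]
  refine (rpow_le_rpow_iff (pNorm_nonneg p x) hS (by linarith : 0 < p)).1 ?_
  rw [pNorm_rpow (by linarith), hsplit hS, Finset.mul_sum]
  refine Finset.sum_le_sum fun i _ => ?_
  rw [hsplit (abs_nonneg _)]
  gcongr
  exact Finset.single_le_sum (f := fun i => |x i|) (fun i _ => abs_nonneg (x i))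
    (Finset.mem_univ i)

theorem sum_abs_le_rpow_mul_pNorm (hp : 1 ≤ p) (x : Fin n → ℝ) :
    ∑ i, |x i| ≤ (n : ℝ) ^ (1 - 1 / p) * pNorm p x := by
  have hS : 0 ≤ ∑ i, |x i| := Finset.sum_nonneg fun i _ => abs_nonneg (x i)
  have hp0 : p ≠ 0 := by linarith
  have h := rpow_sum_le_const_mul_sum_rpow Finset.univ x hp
  rw [Finset.card_univ, Fintype.card_fin, ← pNorm_rpow hp0] at h
  refine (rpow_le_rpow_iff hS (mul_nonneg (by positivity) (pNorm_nonneg p x))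
    (by linarith : 0 < p)).1 (h.trans_eq ?_)
  rw [mul_rpow (by positivity) (pNorm_nonneg p x), ← rpow_mul (by positivity)]
  congr 2
  field_simp

theorem abs_apply_le_pNorm (hp : 0 < p) (x : Fin n → ℝ) (i : Fin n) : |x i| ≤ pNorm p x := by
  refine (rpow_le_rpow_iff (abs_nonneg _) (pNorm_nonneg p x) hp).1 ?_
  rw [pNorm_rpow hp.ne']
  exact Finset.single_le_sum (f := fun i => |x i| ^ p)
    (fun _ _ => rpow_nonneg (abs_nonneg _) _) (Finset.mem_univ i)

theorem pNorm_zero (hp : p ≠ 0) : pNorm p (0 : Fin n → ℝ) = 0 := by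
  simp [pNorm, zero_rpow hp, zero_rpow (inv_ne_zero hp)]

theorem pNorm_pos (hp : 0 < p) {x : Fin n → ℝ} (hx : x ≠ 0) : 0 < pNorm p x := by
  obtain ⟨i, hi⟩ := Function.ne_iff.1 hx
  exact (abs_pos.2 hi).trans_le (abs_apply_le_pNorm hp x i)

theorem continuous_pNorm (hp : 0 ≤ p) : Continuous (pNorm p : (Fin n → ℝ) → ℝ) :=
  .rpow_const
    (continuous_finsetSum _ fun i _ => (continuous_apply i).abs.rpow_const fun _ => .inr hp)
    fun _ => .inr (one_div_nonneg.2 hp)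

theorem volume_setOf_pNorm_le_ne_top (hp : 0 < p) (r : ℝ) :
    volume {x : Fin n → ℝ | pNorm p x ≤ r} ≠ ∞ := by
  refine measure_ne_top_of_subset (fun x hx => ?_)
    (measure_closedBall_lt_top (x := (0 : Fin n → ℝ)) (r := r)).ne
  rw [mem_closedBall_zero_iff, pi_norm_le_iff_of_nonneg ((pNorm_nonneg p x).trans hx)]
  exact fun i => (abs_apply_le_pNorm hp x i).trans hx

theorem volume_pBall_ne_zero (hp : 0 < p) : volume (pBall n p) ≠ 0 := by
  have hopen : IsOpen {x : Fin n → ℝ | pNorm p x < 1} :=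
    isOpen_lt (continuous_pNorm hp.le) continuous_const
  refine ((hopen.measure_pos volume ⟨0, ?_⟩).trans_le
    (measure_mono fun x hx => (mem_ofPred_eq ▸ hx).le)).ne'
  simp [pNorm_zero hp.ne']

end PNorm

theorem pi_tilted {ι : Type*} [Fintype ι] {α : ι → Type*} [∀ i, MeasurableSpace (α i)]
    (μ : ∀ i, Measure (α i)) [∀ i, SigmaFinite (μ i)] (f : ∀ i, α i → ℝ) :
    Measure.pi (fun i => (μ i).tilted (f i))
      = (Measure.pi μ).tilted fun x => ∑ i, f i (x i) := by
  have hprod (ν : ∀ i, Measure (α i)) [∀ i, SigmaFinite (ν i)] :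
      ∫ x, ∏ i, exp (f i (x i)) ∂Measure.pi ν = ∏ i, ∫ x, exp (f i x) ∂ν i :=
    integral_fintype_prod_eq_prod fun i x => exp (f i x)
  refine Measure.pi_eq fun s hs => ?_
  simp only [tilted_apply_eq_ofReal_integral' _ (MeasurableSet.univ_pi hs),
    tilted_apply_eq_ofReal_integral' _ (hs _), Measure.restrict_pi_pi, exp_sum, integral_div,
    hprod]
  rw [← Finset.prod_div_distrib]
  exact ENNReal.ofReal_prod_of_nonneg fun i _ => by positivity

section ProductMeasure

variable {n : ℕ} {p : ℝ}

theorem pi_pGaussian (hp : p ≠ 0) :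
    Measure.pi (fun _ : Fin n => pGaussian p) = volume.tilted fun x => -pNorm p x ^ p := by
  simp only [pGaussian, pi_tilted, pNorm_rpow hp, Finset.sum_neg_distrib, volume_pi]

theorem integrable_abs_apply_pi_pGaussian (hp : 1 ≤ p) (i : Fin n) :
    Integrable (fun x => |x i|) (Measure.pi fun _ : Fin n => pGaussian p) :=
  have := isProbabilityMeasure_pGaussian hp
  (measurePreserving_eval (fun _ => pGaussian p) i).integrable_comp_of_integrable
    (integrable_abs_pGaussian hp)

theorem integrable_pNorm_pi_pGaussian (hp : 1 ≤ p) :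
    Integrable (pNorm p) (Measure.pi fun _ : Fin n => pGaussian p) :=
  (integrable_finsetSum _ fun i _ => integrable_abs_apply_pi_pGaussian hp i).mono'
    (measurable_pNorm p).aestronglyMeasurable <| ae_of_all _ fun x => by
      rw [norm_of_nonneg (pNorm_nonneg p x)]
      exact pNorm_le_sum_abs hp x

theorem rpow_mul_le_integral_pNorm_pi_pGaussian (hn : 0 < n) (hp : 1 ≤ p) :
    (n : ℝ) ^ (1 / p) * (exp (-2) / 2)
      ≤ ∫ x, pNorm p x ∂Measure.pi fun _ : Fin n => pGaussian p := by
  have := isProbabilityMeasure_pGaussian hp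
  have hn' : (0 : ℝ) < n := by exact_mod_cast hn
  refine le_of_mul_le_mul_left ?_ (rpow_pos_of_pos hn' (1 - 1 / p))
  calc (n : ℝ) ^ (1 - 1 / p) * (n ^ (1 / p) * (exp (-2) / 2))
      = n * (exp (-2) / 2) := by
        rw [← mul_assoc, ← rpow_add hn', sub_add_cancel, rpow_one]
    _ ≤ n * ∫ t, |t| ∂pGaussian p := by
        gcongr
        exact exp_neg_two_div_two_le_integral_abs_pGaussian hp
    _ = ∫ x, ∑ i, |x i| ∂Measure.pi fun _ : Fin n => pGaussian p := by
        rw [integral_finsetSum _ fun i _ => integrable_abs_apply_pi_pGaussian hp i]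
        simp only [integral_comp_eval (μ := fun _ : Fin n => pGaussian p) (f := fun t => |t|)
          continuous_abs.aestronglyMeasurable, Finset.sum_const, Finset.card_univ,
          Fintype.card_fin, nsmul_eq_mul]
    _ ≤ ∫ x, (n : ℝ) ^ (1 - 1 / p) * pNorm p x ∂Measure.pi fun _ : Fin n => pGaussian p :=
        integral_mono (integrable_finsetSum _ fun i _ => integrable_abs_apply_pi_pGaussian hp i)
          ((integrable_pNorm_pi_pGaussian hp).const_mul _) (sum_abs_le_rpow_mul_pNorm hp)
    _ = (n : ℝ) ^ (1 - 1 / p) * ∫ x, pNorm p x ∂Measure.pi fun _ : Fin n => pGaussian p :=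
        integral_const_mul _ _

end ProductMeasure

section LinearForm

variable {n : ℕ} {p s : ℝ} {θ : Fin n → ℝ}

theorem iIndepFun_eval_mul_pi_pGaussian (hp : 1 ≤ p) (θ : Fin n → ℝ) :
    iIndepFun (fun i (x : Fin n → ℝ) => x i * θ i) (Measure.pi fun _ => pGaussian p) :=
  have := isProbabilityMeasure_pGaussian hp
  iIndepFun_pi (X := fun i t => t * θ i) fun _ => by fun_prop

theorem integrable_exp_mul_linearForm_pi_pGaussian (hp : 1 ≤ p) (hθ : ∀ i, |s * θ i| ≤ 1 / 4) :
    Integrable (fun x => exp (s * ∑ i, x i * θ i)) (Measure.pi fun _ => pGaussian p) := by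
  have := isProbabilityMeasure_pGaussian hp
  have h := (iIndepFun_eval_mul_pi_pGaussian hp θ).integrable_exp_mul_sum (t := s)
    (fun i => by fun_prop) (s := Finset.univ) fun i _ =>
      (measurePreserving_eval (fun _ => pGaussian p) i).integrable_comp_of_integrable
        (g := fun t => exp (s * (t * θ i))) ?_
  · simpa only [Finset.sum_apply] using h
  · simpa only [mul_left_comm s, mul_comm, id_eq] using integrable_exp_mul_of_integrable_exp_mul_abs
      aemeasurable_id (integrable_exp_mul_abs_pGaussian hp one_half_lt_one)
      ((hθ i).trans (by norm_num))

theorem mgf_linearForm_pi_pGaussian_le (hp : 1 ≤ p) (hθ : ∀ i, |s * θ i| ≤ 1 / 4) :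
    mgf (fun x => ∑ i, x i * θ i) (Measure.pi fun _ => pGaussian p) s
      ≤ exp (64 * exp 2 * (s ^ 2 * ∑ i, θ i ^ 2)) := by
  have := isProbabilityMeasure_pGaussian hp
  have hcoord (i : Fin n) : mgf (fun x => x i * θ i) (Measure.pi fun _ => pGaussian p) s
      = mgf id (pGaussian p) (s * θ i) := by
    simp only [mgf, id_eq, mul_right_comm s, mul_assoc]
    exact integral_comp_eval (μ := fun _ : Fin n => pGaussian p)
      (f := fun t => exp (s * (t * θ i))) (by fun_prop)
  calc mgf (fun x => ∑ i, x i * θ i) (Measure.pi fun _ => pGaussian p) s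
      = ∏ i, mgf id (pGaussian p) (s * θ i) := by
        rw [← Finset.prod_congr rfl fun i _ => hcoord i,
          ← (iIndepFun_eval_mul_pi_pGaussian hp θ).mgf_sum fun i => by fun_prop]
        simp only [Finset.sum_fn]
    _ ≤ ∏ i, exp (64 * exp 2 * (s * θ i) ^ 2) :=
        Finset.prod_le_prod (fun _ _ => mgf_nonneg) fun i _ => mgf_id_pGaussian_le hp (hθ i)
    _ = exp (64 * exp 2 * (s ^ 2 * ∑ i, θ i ^ 2)) := by
        rw [← exp_sum, Finset.mul_sum, Finset.mul_sum]
        simp only [mul_pow]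

end LinearForm

/-! ### Polar decomposition and the cone measure -/

section PolarDecomposition

variable {n : ℕ} {p : ℝ}

/-- The radial projection `x ↦ x / ‖x‖_p` onto the unit sphere of `ℓ_p^n`, the angular part of the
polar decomposition `x = pNorm p x • radialProj p x`. Junk value `radialProj p 0 = 0`. -/
noncomputable def radialProj (p : ℝ) (x : Fin n → ℝ) : Fin n → ℝ := (pNorm p x)⁻¹ • x

theorem measurable_radialProj (p : ℝ) : Measurable (radialProj p : (Fin n → ℝ) → Fin n → ℝ) :=
  (measurable_pNorm p).inv.smul measurable_id

theorem radialProj_mem_pSphere (hp : 1 ≤ p) {x : Fin n → ℝ} (hx : x ≠ 0) :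
    radialProj p x ∈ pSphere n p := by
  have hpos := pNorm_pos (by linarith) hx
  change pNorm p ((pNorm p x)⁻¹ • x) = 1
  rw [pNorm_smul hp (inv_nonneg.2 hpos.le), inv_mul_cancel₀ hpos.ne']

theorem radialProj_smul (hp : 1 ≤ p) {r : ℝ} (hr : 0 < r) (x : Fin n → ℝ) :
    radialProj p (r • x) = radialProj p x := by
  rw [radialProj, pNorm_smul hp hr.le, smul_smul, mul_inv, mul_right_comm,
    inv_mul_cancel₀ hr.ne', one_mul, radialProj]

theorem pNorm_smul_radialProj (hp : 0 < p) (x : Fin n → ℝ) :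
    pNorm p x • radialProj p x = x := by
  rcases eq_or_ne x 0 with rfl | hx
  · simp [radialProj]
  · rw [radialProj, smul_inv_smul₀ (pNorm_pos hp hx).ne']

theorem map_coneMeasure_apply (hn : 0 < n) (hp : 1 ≤ p) {A : Set (Fin n → ℝ)}
    (hA : MeasurableSet A) :
    (coneMeasure n p hp).map Subtype.val A
      = volume (radialProj p ⁻¹' A ∩ pBall n p) / volume (pBall n p) := by
  have hp0 : 0 < p := by linarith
  have : Nonempty (Fin n) := ⟨⟨0, hn⟩⟩
  have hcone : cone (pSphere n p ∩ A) \ {0} = (radialProj p ⁻¹' A ∩ pBall n p) \ {0} := by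
    rw [cone_diff_zero hp inter_subset_left]
    ext y
    constructor
    · rintro ⟨hpos, hle, -, hmem⟩
      refine ⟨⟨hmem, hle⟩, ?_⟩
      rintro rfl
      exact hpos.ne' (pNorm_zero hp0.ne')
    · rintro ⟨⟨hmem, hle⟩, hne⟩
      exact ⟨pNorm_pos hp0 hne, hle, radialProj_mem_pSphere hp hne, hmem⟩
  rw [Measure.map_apply measurable_subtype_coe hA, coneMeasure,
    Measure.ofMeasurable_apply _ (measurable_subtype_coe hA), Subtype.image_preimage_coe,
    ← measure_sdiff_null (s := cone _) (measure_singleton 0), hcone,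
    measure_sdiff_null (measure_singleton 0)]

theorem volume_radialProj_preimage_inter (hp : 1 ≤ p) (A : Set (Fin n → ℝ)) {r : ℝ}
    (hr : 0 < r) :
    volume (radialProj p ⁻¹' A ∩ {x | pNorm p x ≤ r})
      = ENNReal.ofReal (r ^ n) * volume (radialProj p ⁻¹' A ∩ pBall n p) := by
  have hpre : radialProj p ⁻¹' A ∩ {x | pNorm p x ≤ r}
      = (r⁻¹ • ·) ⁻¹' (radialProj p ⁻¹' A ∩ pBall n p) := by
    ext x
    simp only [mem_inter_iff, mem_preimage, radialProj_smul hp (inv_pos.2 hr), pBall,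
      mem_ofPred_eq, pNorm_smul hp (inv_nonneg.2 hr.le), inv_mul_le_iff₀ hr, mul_one]
  rw [hpre, Measure.addHaar_preimage_smul volume (inv_ne_zero hr.ne'), Module.finrank_fin_fun,
    inv_pow, inv_inv, abs_of_pos (pow_pos hr n)]

theorem volume_radialProj_preimage_inter_eq_mul (hn : 0 < n) (hp : 1 ≤ p)
    {A : Set (Fin n → ℝ)} (hA : MeasurableSet A) (r : ℝ) :
    volume (radialProj p ⁻¹' A ∩ {x | pNorm p x ≤ r})
      = (coneMeasure n p hp).map Subtype.val A * volume {x : Fin n → ℝ | pNorm p x ≤ r} := by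
  have hp0 : 0 < p := by linarith
  have : Nonempty (Fin n) := ⟨⟨0, hn⟩⟩
  rcases le_or_gt r 0 with hr | hr
  · have hnull : volume {x : Fin n → ℝ | pNorm p x ≤ r} = 0 :=
      measure_mono_null (fun x hx => by_contra fun hne => (pNorm_pos hp0 hne).not_ge (hx.trans hr))
        (measure_singleton (0 : Fin n → ℝ))
    rw [hnull, measure_mono_null inter_subset_right hnull, mul_zero]
  · have hball := volume_radialProj_preimage_inter hp (univ : Set (Fin n → ℝ)) hr
    simp only [preimage_univ, univ_inter] at hball
    rw [volume_radialProj_preimage_inter hp A hr, hball, map_coneMeasure_apply hn hp hA,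
      mul_left_comm, ENNReal.div_mul_cancel (volume_pBall_ne_zero hp0)
        (volume_setOf_pNorm_le_ne_top hp0 1)]

theorem map_pNorm_restrict_radialProj_preimage (hn : 0 < n) (hp : 1 ≤ p)
    {A : Set (Fin n → ℝ)} (hA : MeasurableSet A) :
    (volume.restrict (radialProj p ⁻¹' A)).map (pNorm p)
      = (coneMeasure n p hp).map Subtype.val A •
        (volume : Measure (Fin n → ℝ)).map (pNorm p) := by
  have hN := measurable_pNorm (n := n) p
  refine Measure.ext_of_generateFrom_of_iUnion (range Iic) (fun k : ℕ => Iic (k : ℝ))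
    (borel_eq_generateFrom_Iic ℝ ▸ BorelSpace.measurable_eq) isPiSystem_Iic
    (eq_univ_of_forall fun x => mem_iUnion.2 (exists_nat_ge x)) (fun k => ⟨_, rfl⟩)
    (fun k => ?_) ?_
  · rw [Measure.map_apply hN measurableSet_Iic]
    exact ne_top_of_le_ne_top (volume_setOf_pNorm_le_ne_top (by linarith) k)
      (Measure.restrict_apply_le _ _)
  · rintro _ ⟨r, rfl⟩
    rw [Measure.smul_apply, Measure.map_apply hN measurableSet_Iic,
      Measure.map_apply hN measurableSet_Iic, Measure.restrict_apply (hN measurableSet_Iic),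
      inter_comm]
    exact volume_radialProj_preimage_inter_eq_mul hn hp hA r

theorem setLIntegral_comp_pNorm (hn : 0 < n) (hp : 1 ≤ p) {A : Set (Fin n → ℝ)}
    (hA : MeasurableSet A) {w : ℝ → ℝ≥0∞} (hw : Measurable w) :
    ∫⁻ x in radialProj p ⁻¹' A, w (pNorm p x)
      = (coneMeasure n p hp).map Subtype.val A * ∫⁻ x : Fin n → ℝ, w (pNorm p x) := by
  have hN := measurable_pNorm (n := n) p
  rw [← lintegral_map hw hN, map_pNorm_restrict_radialProj_preimage hn hp hA,
    lintegral_smul_measure, lintegral_map hw hN, smul_eq_mul]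

theorem withDensity_comp_pNorm_inter_preimage (hn : 0 < n) (hp : 1 ≤ p) {w : ℝ → ℝ≥0∞}
    (hw : Measurable w) {S : Set ℝ} (hS : MeasurableSet S) {A : Set (Fin n → ℝ)}
    (hA : MeasurableSet A) :
    volume.withDensity (fun x => w (pNorm p x)) (pNorm p ⁻¹' S ∩ radialProj p ⁻¹' A)
      = (volume : Measure (Fin n → ℝ)).withDensity (fun x => w (pNorm p x)) (pNorm p ⁻¹' S)
        * (coneMeasure n p hp).map Subtype.val A := by
  have hS' : MeasurableSet (pNorm p ⁻¹' S : Set (Fin n → ℝ)) := measurable_pNorm p hS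
  have hind : (pNorm p ⁻¹' S : Set (Fin n → ℝ)).indicator (fun x => w (pNorm p x))
      = fun x => S.indicator w (pNorm p x) := rfl
  rw [withDensity_apply _ (hS'.inter (measurable_radialProj p hA)), withDensity_apply _ hS',
    ← setLIntegral_indicator hS', ← lintegral_indicator hS', hind,
    setLIntegral_comp_pNorm hn hp hA (hw.indicator hS), mul_comm]

variable {w : ℝ → ℝ≥0∞}
  [IsProbabilityMeasure ((volume : Measure (Fin n → ℝ)).withDensity fun x => w (pNorm p x))]

theorem map_radialProj_withDensity_comp_pNorm (hn : 0 < n) (hp : 1 ≤ p) (hw : Measurable w) :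
    (volume.withDensity fun x => w (pNorm p x)).map (radialProj p)
      = (coneMeasure n p hp).map Subtype.val := by
  ext A hA
  rw [Measure.map_apply (measurable_radialProj p) hA, ← univ_inter (radialProj p ⁻¹' A),
    ← preimage_univ (f := pNorm p),
    withDensity_comp_pNorm_inter_preimage hn hp hw MeasurableSet.univ hA, preimage_univ,
    measure_univ, one_mul]

theorem indepFun_pNorm_radialProj (hn : 0 < n) (hp : 1 ≤ p) (hw : Measurable w) :
    IndepFun (pNorm p) (radialProj p)
      ((volume : Measure (Fin n → ℝ)).withDensity fun x => w (pNorm p x)) := by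
  refine indepFun_iff_measure_inter_preimage_eq_mul.2 fun S A hS hA => ?_
  rw [withDensity_comp_pNorm_inter_preimage hn hp hw hS hA,
    ← map_radialProj_withDensity_comp_pNorm hn hp hw,
    Measure.map_apply (measurable_radialProj p) hA]

end PolarDecomposition

section ConeMeasureLaw

variable {n : ℕ} {p : ℝ}

theorem exists_pi_pGaussian_eq_withDensity_comp_pNorm (hp : p ≠ 0) :
    ∃ w : ℝ → ℝ≥0∞, Measurable w ∧ Measure.pi (fun _ : Fin n => pGaussian p)
      = volume.withDensity fun x => w (pNorm p x) :=
  ⟨fun r => .ofReal (exp (-r ^ p) / ∫ x : Fin n → ℝ, exp (-pNorm p x ^ p)), by fun_prop,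
    pi_pGaussian hp⟩

theorem map_radialProj_pi_pGaussian (hn : 0 < n) (hp : 1 ≤ p) :
    (Measure.pi fun _ : Fin n => pGaussian p).map (radialProj p)
      = (coneMeasure n p hp).map Subtype.val := by
  have := isProbabilityMeasure_pGaussian hp
  have hprob : IsProbabilityMeasure (Measure.pi fun _ : Fin n => pGaussian p) := inferInstance
  obtain ⟨w, hw, heq⟩ := exists_pi_pGaussian_eq_withDensity_comp_pNorm (n := n) (p := p)
    (by linarith)
  rw [heq] at hprob ⊢
  exact map_radialProj_withDensity_comp_pNorm hn hp hw

theorem indepFun_pNorm_radialProj_pi_pGaussian (hn : 0 < n) (hp : 1 ≤ p) :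
    IndepFun (pNorm p) (radialProj p) (Measure.pi fun _ : Fin n => pGaussian p) := by
  have := isProbabilityMeasure_pGaussian hp
  have hprob : IsProbabilityMeasure (Measure.pi fun _ : Fin n => pGaussian p) := inferInstance
  obtain ⟨w, hw, heq⟩ := exists_pi_pGaussian_eq_withDensity_comp_pNorm (n := n) (p := p)
    (by linarith)
  rw [heq] at hprob ⊢
  exact indepFun_pNorm_radialProj hn hp hw

theorem isProbabilityMeasure_coneMeasure (hn : 0 < n) (hp : 1 ≤ p) :
    IsProbabilityMeasure (coneMeasure n p hp) := by
  have := isProbabilityMeasure_pGaussian hp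
  have hmap := Measure.isProbabilityMeasure_map (μ := Measure.pi fun _ : Fin n => pGaussian p)
    (measurable_radialProj p).aemeasurable
  rw [map_radialProj_pi_pGaussian hn hp] at hmap
  exact (Measure.isProbabilityMeasure_map_iff measurable_subtype_coe.aemeasurable).1 hmap

theorem integral_coneMeasure (hn : 0 < n) (hp : 1 ≤ p) {f : (Fin n → ℝ) → ℝ}
    (hf : Measurable f) :
    ∫ x, f x ∂coneMeasure n p hp
      = ∫ x, f (radialProj p x) ∂Measure.pi fun _ : Fin n => pGaussian p := by
  rw [← integral_map measurable_subtype_coe.aemeasurable hf.aestronglyMeasurable,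
    ← map_radialProj_pi_pGaussian hn hp,
    integral_map (measurable_radialProj p).aemeasurable hf.aestronglyMeasurable]

end ConeMeasureLaw

/-! ### Linear forms on the sphere -/

section Jensen

variable {Ω : Type*} [MeasurableSpace Ω] {μ : Measure Ω} [IsProbabilityMeasure μ] {R V : Ω → ℝ}

theorem exp_integral_mul_le_integral_exp_mul (hR : Integrable R μ) (v : ℝ)
    (hexp : Integrable (fun ω => exp (R ω * v)) μ) :
    exp (μ[R] * v) ≤ ∫ ω, exp (R ω * v) ∂μ := by
  rw [← integral_mul_const]
  exact convexOn_exp.map_integral_le continuous_exp.continuousOn isClosed_univ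
    (.of_forall fun _ => mem_univ _) (hR.mul_const v) hexp

theorem integral_exp_integral_mul_le_of_indepFun (hRV : IndepFun R V μ) (hR : Integrable R μ)
    (hV : AEMeasurable V μ) (hexp : Integrable (fun ω => exp (R ω * V ω)) μ) :
    ∫ ω, exp (μ[R] * V ω) ∂μ ≤ ∫ ω, exp (R ω * V ω) ∂μ := by
  have hRm := hR.aemeasurable
  have hprod := (indepFun_iff_map_prod_eq_prod_map_map hRm hV).1 hRV
  have hG : Measurable fun z : ℝ × ℝ => exp (z.1 * z.2) := by fun_prop
  have hint : Integrable (fun z : ℝ × ℝ => exp (z.1 * z.2)) ((μ.map R).prod (μ.map V)) := by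
    rw [← hprod]
    exact (integrable_map_measure hG.aestronglyMeasurable (hRm.prodMk hV)).2 hexp
  have := Measure.isProbabilityMeasure_map hRm
  have hmean : ∫ r, r ∂μ.map R = μ[R] := integral_map hRm aestronglyMeasurable_id
  have hidR : Integrable id (μ.map R) :=
    (integrable_map_measure aestronglyMeasurable_id hRm).2 hR
  calc
    _ = ∫ v, exp (μ[R] * v) ∂μ.map V :=
      (integral_map hV (f := fun v => exp (μ[R] * v)) (by fun_prop)).symm
    _ ≤ ∫ v, ∫ r, exp (r * v) ∂μ.map R ∂μ.map V := by
      refine integral_mono_of_nonneg (.of_forall fun _ => (exp_pos _).le)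
        hint.integral_prod_right ?_
      filter_upwards [hint.prod_left_ae] with v hv
      exact hmean ▸ exp_integral_mul_le_integral_exp_mul hidR v hv
    _ = ∫ z, exp (z.1 * z.2) ∂(μ.map R).prod (μ.map V) := (integral_prod_symm _ hint).symm
    _ = _ := by rw [← hprod, integral_map (hRm.prodMk hV) hG.aestronglyMeasurable]

end Jensen

section Sphere

variable {n : ℕ} {p : ℝ} {θ : Fin n → ℝ}

theorem mgf_linearForm_coneMeasure_integral_pNorm_mul_le (hn : 0 < n) (hp : 1 ≤ p) {s : ℝ}
    (hθ : ∀ i, |s * θ i| ≤ 1 / 4) :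
    mgf (fun x : pSphere n p => ∑ i, (x : Fin n → ℝ) i * θ i) (coneMeasure n p hp)
        ((∫ x, pNorm p x ∂Measure.pi fun _ : Fin n => pGaussian p) * s)
      ≤ exp (64 * exp 2 * (s ^ 2 * ∑ i, θ i ^ 2)) := by
  set ν := Measure.pi fun _ : Fin n => pGaussian p
  have := isProbabilityMeasure_pGaussian hp
  have hpolar (x : Fin n → ℝ) :
      pNorm p x * (s * ∑ i, radialProj p x i * θ i) = s * ∑ i, x i * θ i := by
    conv_rhs => rw [← pNorm_smul_radialProj (p := p) (by linarith) x]
    simp only [Pi.smul_apply, smul_eq_mul, Finset.mul_sum]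
    exact Finset.sum_congr rfl fun i _ => by ring
  have hV : Measurable fun x : Fin n → ℝ => s * ∑ i, x i * θ i := by fun_prop
  calc
    _ = ∫ x, exp (ν[pNorm p] * (s * ∑ i, radialProj p x i * θ i)) ∂ν := by
      rw [mgf, ← integral_coneMeasure hn hp
        (f := fun x => exp (ν[pNorm p] * (s * ∑ i, x i * θ i))) (by fun_prop)]
      simp only [mul_assoc]
    _ ≤ ∫ x, exp (pNorm p x * (s * ∑ i, radialProj p x i * θ i)) ∂ν := by
      refine integral_exp_integral_mul_le_of_indepFun
        ((indepFun_pNorm_radialProj_pi_pGaussian hn hp).comp measurable_id hV)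
        (integrable_pNorm_pi_pGaussian hp) (hV.comp (measurable_radialProj p)).aemeasurable ?_
      simpa only [hpolar] using integrable_exp_mul_linearForm_pi_pGaussian hp hθ
    _ = mgf (fun x => ∑ i, x i * θ i) ν s := by simp only [hpolar, mgf]
    _ ≤ _ := mgf_linearForm_pi_pGaussian_le hp hθ

theorem mgf_linearForm_coneMeasure_le (hn : 0 < n) (hp : 1 ≤ p) {v : ℝ}
    (hv : ∀ i, |v * θ i| ≤ n ^ (1 / p) * (exp (-2) / 2) / 4) :
    mgf (fun x : pSphere n p => ∑ i, (x : Fin n → ℝ) i * θ i) (coneMeasure n p hp) v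
      ≤ exp (64 * exp 2 * ((v / (n ^ (1 / p) * (exp (-2) / 2))) ^ 2 * ∑ i, θ i ^ 2)) := by
  set ρ := ∫ x, pNorm p x ∂Measure.pi fun _ : Fin n => pGaussian p with hρ_def
  set m := (n : ℝ) ^ (1 / p) * (exp (-2) / 2)
  have hm : 0 < m := by positivity
  have hρ : m ≤ ρ := rpow_mul_le_integral_pNorm_pi_pGaussian hn hp
  have hρ0 : 0 < ρ := hm.trans_le hρ
  have hs (i : Fin n) : |v / ρ * θ i| ≤ 1 / 4 := by
    rw [div_mul_eq_mul_div, abs_div, abs_of_pos hρ0, div_le_iff₀ hρ0]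
    linarith [hv i]
  have hmgf := mgf_linearForm_coneMeasure_integral_pNorm_mul_le hn hp hs
  rw [← hρ_def, mul_div_cancel₀ v hρ0.ne'] at hmgf
  refine hmgf.trans (exp_le_exp.2 ?_)
  have hsq : (v / ρ) ^ 2 ≤ (v / m) ^ 2 := by
    rw [div_pow, div_pow]
    gcongr
  gcongr

/-- The linear form `⟨·, θ⟩` on the unit sphere of `ℓ_p^n`, scaled by `n ^ (1 / p - 1 / 2)` so that
its sub-Gaussian constant does not depend on `n` when `|θ i| ≤ 1` for all `i`. -/
noncomputable def normalizedForm (p : ℝ) (θ : Fin n → ℝ) (x : pSphere n p) : ℝ :=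
  1 / (n : ℝ) ^ (1 / 2 - 1 / p) * ∑ i, (x : Fin n → ℝ) i * θ i

theorem one_div_rpow_half_sub (hn : 0 < n) :
    1 / (n : ℝ) ^ (1 / 2 - 1 / p) = n ^ (1 / p) / √n := by
  rw [rpow_sub (by positivity), one_div_div, sqrt_eq_rpow]

theorem abs_normalizedForm_le (hn : 0 < n) (hp : 1 ≤ p) (hθ : ∀ i, |θ i| ≤ 1)
    (x : pSphere n p) : |normalizedForm p θ x| ≤ √n := by
  have hsum : |∑ i, (x : Fin n → ℝ) i * θ i| ≤ n ^ (1 - 1 / p) :=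
    calc
      _ ≤ ∑ i, |(x : Fin n → ℝ) i| := by
        refine (Finset.abs_sum_le_sum_abs _ _).trans (Finset.sum_le_sum fun i _ => ?_)
        rw [abs_mul]
        exact mul_le_of_le_one_right (abs_nonneg _) (hθ i)
      _ ≤ n ^ (1 - 1 / p) * pNorm p (x : Fin n → ℝ) := sum_abs_le_rpow_mul_pNorm hp x.1
      _ = n ^ (1 - 1 / p) := by rw [show pNorm p (x : Fin n → ℝ) = 1 from x.2, mul_one]
  have hn0 : (0 : ℝ) < n := by positivity
  calc
    |normalizedForm p θ x| ≤ 1 / (n : ℝ) ^ (1 / 2 - 1 / p) * n ^ (1 - 1 / p) := by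
      rw [normalizedForm, abs_mul, abs_of_nonneg (by positivity)]
      gcongr
    _ = √n := by
      rw [one_div, ← rpow_neg hn0.le, ← rpow_add hn0, sqrt_eq_rpow]
      congr 1
      ring

theorem mgf_normalizedForm_le_of_abs_le (hn : 0 < n) (hp : 1 ≤ p) (hθ : ∀ i, |θ i| ≤ 1) {u : ℝ}
    (hu : |u| ≤ exp (-2) / 8 * √n) :
    mgf (normalizedForm p θ) (coneMeasure n p hp) u ≤ exp (256 * exp 6 * u ^ 2) := by
  have hn0 : (0 : ℝ) < n := by positivity
  set q := (n : ℝ) ^ (1 / p)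
  have hq : 0 < q := by positivity
  have hv (i : Fin n) : |q / √n * u * θ i| ≤ q * (exp (-2) / 2) / 4 :=
    calc
      |q / √n * u * θ i| ≤ q / √n * |u| := by
        rw [abs_mul, abs_mul, abs_of_pos (by positivity : 0 < q / √n)]
        exact mul_le_of_le_one_right (by positivity) (hθ i)
      _ ≤ q / √n * (exp (-2) / 8 * √n) := by gcongr
      _ = q * (exp (-2) / 2) / 4 := by
        field_simp
        norm_num
  have hsum : ∑ i, θ i ^ 2 ≤ n := by
    simpa using Finset.sum_le_card_nsmul Finset.univ (fun i => θ i ^ 2) 1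
      fun i _ => (sq_le_one_iff_abs_le_one _).2 (hθ i)
  unfold normalizedForm
  rw [mgf_const_mul, one_div_rpow_half_sub hn]
  refine (mgf_linearForm_coneMeasure_le hn hp hv).trans (exp_le_exp.2 ?_)
  calc
    64 * exp 2 * ((q / √n * u / (q * (exp (-2) / 2))) ^ 2 * ∑ i, θ i ^ 2)
      ≤ 64 * exp 2 * ((q / √n * u / (q * (exp (-2) / 2))) ^ 2 * n) := by gcongr
    _ = 256 * exp 6 * u ^ 2 := by
      have hexp : exp 6 * exp (-2) ^ 2 = exp 2 := by
        rw [← exp_nat_mul, ← exp_add]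
        norm_num
      rw [← hexp]
      field_simp
      rw [sq_sqrt hn0.le]
      ring

theorem mul_normalizedForm_le_of_lt_abs (hn : 0 < n) (hp : 1 ≤ p) (hθ : ∀ i, |θ i| ≤ 1) {u : ℝ}
    (hu : exp (-2) / 8 * √n < |u|) (x : pSphere n p) :
    u * normalizedForm p θ x ≤ 256 * exp 6 * u ^ 2 := by
  have hsqrt : √n ≤ 8 * exp 2 * |u| := by
    rw [exp_neg] at hu
    field_simp at hu
    linarith
  have hexp : exp 2 ≤ exp 6 := exp_le_exp.2 (by norm_num)
  calc
    u * normalizedForm p θ x ≤ |u| * √n := by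
      refine (le_abs_self _).trans ?_
      rw [abs_mul]
      gcongr
      exact abs_normalizedForm_le hn hp hθ x
    _ ≤ |u| * (8 * exp 2 * |u|) := by gcongr
    _ = 8 * exp 2 * u ^ 2 := by rw [← sq_abs u]; ring
    _ ≤ 256 * exp 6 * u ^ 2 := by gcongr; norm_num

theorem integrable_exp_mul_normalizedForm (hn : 0 < n) (hp : 1 ≤ p) (hθ : ∀ i, |θ i| ≤ 1)
    (u : ℝ) : Integrable (fun x => exp (u * normalizedForm p θ x)) (coneMeasure n p hp) := by
  have := isProbabilityMeasure_coneMeasure hn hp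
  have hform : Measurable fun x : Fin n → ℝ =>
      1 / (n : ℝ) ^ (1 / 2 - 1 / p) * ∑ i, x i * θ i := by fun_prop
  have hmeas : Measurable (normalizedForm p θ) := hform.comp measurable_subtype_coe
  exact integrable_exp_mul_of_mem_Icc hmeas.aemeasurable
    (.of_forall fun x => abs_le.1 (abs_normalizedForm_le hn hp hθ x))

theorem hasSubgaussianMGF_normalizedForm (hn : 0 < n) (hp : 1 ≤ p) (hθ : ∀ i, |θ i| ≤ 1) :
    HasSubgaussianMGF (normalizedForm p θ) (512 * (exp 6).toNNReal) (coneMeasure n p hp) where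
  integrable_exp_mul := integrable_exp_mul_normalizedForm hn hp hθ
  mgf_le u := by
    have := isProbabilityMeasure_coneMeasure hn hp
    have hproxy : ((512 * (exp 6).toNNReal : ℝ≥0) : ℝ) * u ^ 2 / 2 = 256 * exp 6 * u ^ 2 := by
      rw [NNReal.coe_mul, coe_toNNReal _ (exp_pos 6).le]
      push_cast
      ring
    rw [hproxy]
    rcases le_or_gt |u| (exp (-2) / 8 * √n) with hu | hu
    · exact mgf_normalizedForm_le_of_abs_le hn hp hθ hu
    · calc
        mgf (normalizedForm p θ) (coneMeasure n p hp) u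
          ≤ ∫ _, exp (256 * exp 6 * u ^ 2) ∂coneMeasure n p hp :=
            integral_mono (integrable_exp_mul_normalizedForm hn hp hθ u) (integrable_const _)
              fun x => exp_le_exp.2 (mul_normalizedForm_le_of_lt_abs hn hp hθ hu x)
        _ = exp (256 * exp 6 * u ^ 2) := by rw [integral_const, probReal_univ, one_smul]

end Sphere

end ConeMeasure

theorem mainTheorem3_general :
    ∃ c : ℝ, 0 < c ∧
      ∀ (n : ℕ) (_ : 1 ≤ n) (p : ℝ) (hp : 1 ≤ p) (θ : Fin n → ℝ) (_ : ‖θ‖ ≤ 1),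
        ConeMeasure.luxemburgNorm ConeMeasure.psi2 (ConeMeasure.coneMeasure n p hp)
          (fun x : ConeMeasure.pSphere n p =>
            1 / (n : ℝ) ^ (1 / 2 - 1 / p) * ∑ i, (x : Fin n → ℝ) i * θ i)
          ≤ ENNReal.ofReal c := by
  refine ⟨2 * √(512 * (Real.exp 6).toNNReal), by positivity, fun n hn p hp θ hθ => ?_⟩
  have := ConeMeasure.isProbabilityMeasure_coneMeasure hn hp
  have hθ' (i : Fin n) : |θ i| ≤ 1 := (norm_le_pi_norm θ i).trans hθ
  exact ConeMeasure.luxemburgNorm_psi2_le_of_hasSubgaussianMGF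
    (ConeMeasure.hasSubgaussianMGF_normalizedForm hn hp hθ') (by positivity)

theorem mainTheorem3 :
    ∃ c : ℝ, 0 < c ∧
      ∀ (n : ℕ) (_ : 1 ≤ n) (p : ℝ) (hp : 1 ≤ p) (_ : p < 2)
        (θ : Fin n → ℝ) (_ : ‖θ‖ = 1),
        ConeMeasure.luxemburgNorm ConeMeasure.psi2 (ConeMeasure.coneMeasure n p hp)
          (fun x : ConeMeasure.pSphere n p =>
            1 / (n : ℝ) ^ (1 / 2 - 1 / p) * ∑ i, (x : Fin n → ℝ) i * θ i)
          ≤ ENNReal.ofReal c := by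
  obtain ⟨c, hc, hbound⟩ := mainTheorem3_general
  exact ⟨c, hc, fun n hn p hp _ θ hθ => hbound n hn p hp θ hθ.le⟩
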